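/- Let $E$ be a real or complex Banach lattice, with positive cone $E^+$. The following statements are equivalent. (i) $E$ satisfies a lower $q$-estimate for some $0<q<\infty$; that is, there are $q\in(0,\infty)$ and a constant $C>0$ such that for every finite sequence $x_1,\dots,x_n$ of mutually disjoint elements of $E$ (i.e. $|x_i|\wedge|x_j|=0$ for $i\ne j$), $$\Big(\sum_{i=1}^n\|x_i\|^q\Big)^{1/q}\le C\,\Big\|\sum_{i=1}^n x_i\Big\| .$$ (ii) $E$ admits an equivalent norm $\|\cdot\|_0$ such that $E$, equipped with $\|\cdot\|_0$ and the same order, is a Banach lattice with the following property (property (C)): for every $c>0$ there exists $\delta=\delta(c)>0$ such that, whenever $x,y,z\in E^+$ satisfy $$x=y+z,\qquad y\wedge z=0,\qquad \|y\|_0=1,\qquad \|z\|_0\ge c,$$ it follows that $\|x\|_0\ge 1+\delta(c)$. Here a complex Banach lattice is the complexification $E=E_{\mathbb R}\oplus iE_{\mathbb R}$ of a real Banach lattice $E_{\mathbb R}$, with modulus $|x+iy|=\sup_{\theta}\big((\cos\theta)x+(\sin\theta)y\big)$, norm $\|z\|=\|\,|z|\,\|$ and positive cone $E^+=E_{\mathbb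 R}^+$. -/

import Mathlib

noncomputable section

/-! Real Banach lattices are the complete normed spaces with a lattice order, compatible with the
vector space operations, and a solid norm. Complex Banach lattices are the complexifications
of real ones. -/

namespace BanachLattice

section Real

variable {E : Type*} [NormedAddCommGroup E] [NormedSpace ℝ E] [Lattice E]

/-- The lower `q`-estimate: for some constant `C > 0`,
`(∑ ‖x i‖ ^ q) ^ (1 / q) ≤ C ‖∑ x i‖` for all finite sequences of mutually disjoint elements. -/
def LowerEstimate (E : Type*) [NormedAddCommGroup E] [Lattice E] (q : ℝ) : Prop :=
  ∃ C : ℝ, 0 < C ∧ ∀ (n : ℕ) (x : Fin n → E),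
    (∀ i j, i ≠ j → |x i| ⊓ |x j| = 0) →
      (∑ i, ‖x i‖ ^ q) ^ (1 / q) ≤ C * ‖∑ i, x i‖

/-- `p` is a norm equivalent to the given one, and it is solid. (The lower bound makes the
seminorm `p` definite, and by equivalence `p` is complete when the given norm is, so that the
space with the norm `p` and the same order is again a Banach lattice.) -/
structure IsEquivLatticeNorm (p : Seminorm ℝ E) : Prop where
  equiv : ∃ a b : ℝ, 0 < a ∧ 0 < b ∧ ∀ x, a * ‖x‖ ≤ p x ∧ p x ≤ b * ‖x‖
  solid : ∀ x y : E, |x| ≤ |y| → p x ≤ p y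

/-- Property (C) for the function `N` (a norm) on the positive cone. -/
def PropertyC (N : E → ℝ) : Prop :=
  ∀ c : ℝ, 0 < c → ∃ δ : ℝ, 0 < δ ∧ ∀ x y z : E, 0 ≤ x → 0 ≤ y → 0 ≤ z →
    x = y + z → y ⊓ z = 0 → N y = 1 → c ≤ N z → 1 + δ ≤ N x

end Real

/-- The complexification `E ⊕ iE`; the pair `(x, y)` stands for `x + iy`. -/
@[ext]
structure Complexification (E : Type*) where
  re : E
  im : E

namespace Complexification

section Algebra

variable {E : Type*} [AddCommGroup E]

instance : Zero (Complexification E) := ⟨⟨0, 0⟩⟩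
instance : Add (Complexification E) := ⟨fun z w => ⟨z.re + w.re, z.im + w.im⟩⟩
instance : Neg (Complexification E) := ⟨fun z => ⟨-z.re, -z.im⟩⟩

@[simp] theorem zero_re : (0 : Complexification E).re = 0 := rfl
@[simp] theorem zero_im : (0 : Complexification E).im = 0 := rfl
@[simp] theorem add_re (z w : Complexification E) : (z + w).re = z.re + w.re := rfl
@[simp] theorem add_im (z w : Complexification E) : (z + w).im = z.im + w.im := rfl
@[simp] theorem neg_re (z : Complexification E) : (-z).re = -z.re := rfl
@[simp] theorem neg_im (z : Complexification E) : (-z).im = -z.im := rfl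

instance : AddCommGroup (Complexification E) where
  add_assoc _ _ _ := by ext <;> simp [add_assoc]
  zero_add _ := by ext <;> simp
  add_zero _ := by ext <;> simp
  add_comm _ _ := by ext <;> simp [add_comm]
  neg_add_cancel _ := by ext <;> simp
  nsmul := nsmulRec
  zsmul := zsmulRec

variable [Module ℝ E]

/-- `(a + ib)(x + iy) = (ax - by) + i(ay + bx)`. -/
instance : SMul ℂ (Complexification E) :=
  ⟨fun c z => ⟨c.re • z.re - c.im • z.im, c.re • z.im + c.im • z.re⟩⟩

@[simp] theorem smul_re (c : ℂ) (z : Complexification E) :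
    (c • z).re = c.re • z.re - c.im • z.im := rfl
@[simp] theorem smul_im (c : ℂ) (z : Complexification E) :
    (c • z).im = c.re • z.im + c.im • z.re := rfl

instance : Module ℂ (Complexification E) where
  one_smul _ := by ext <;> simp
  mul_smul _ _ _ := by ext <;> simp <;> module
  smul_zero _ := by ext <;> simp
  smul_add _ _ _ := by ext <;> simp <;> module
  add_smul _ _ _ := by ext <;> simp <;> module
  zero_smul _ := by ext <;> simp

/-- The embedding of `E` as the real part of its complexification. -/
def ofReal (x : E) : Complexification E := ⟨x, 0⟩

end Algebra

variable {E : Type*} [NormedAddCommGroup E] [NormedSpace ℝ E] [CompleteSpace E] [Lattice E]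
  [IsOrderedAddMonoid E] [IsOrderedModule ℝ E] [HasSolidNorm E]

/-- In a Banach lattice the supremum over `θ` of `(cos θ) x + (sin θ) y` exists. -/
theorem exists_isLUB (z : Complexification E) :
    ∃ m : E, IsLUB (Set.range fun θ : ℝ => Real.cos θ • z.re + Real.sin θ • z.im) m := by
  obtain ⟨x, y⟩ := z
  simp only
  set f : ℝ → E := fun θ => Real.cos θ • x + Real.sin θ • y with hf
  set u : E := |x| + |y| with hu
  have hu0 : 0 ≤ u := add_nonneg (abs_nonneg x) (abs_nonneg y)
  have hsm : ∀ (r ε : ℝ) (v : E), |r| ≤ ε → r • v ≤ ε • |v| := by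
    intro r ε v hr
    have h0 : (0 : E) ≤ |v| := abs_nonneg v
    have h1 : r • v ≤ |r| • |v| := by
      rcases le_total 0 r with h | h
      · rw [abs_of_nonneg h]
        exact smul_le_smul_of_nonneg_left (le_abs_self v) h
      · rw [abs_of_nonpos h, ← neg_smul_neg r v]
        exact smul_le_smul_of_nonneg_left (neg_le_abs v) (by linarith)
    exact h1.trans (smul_le_smul_of_nonneg_right hr h0)
  have hnet : ∀ n : ℕ, ∃ t : Finset ℝ, t.Nonempty ∧
      ∀ θ : ℝ, ∃ φ ∈ t, f θ ≤ f φ + ((1 / 2 : ℝ) ^ n) • u := by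
    intro n
    have hε : (0 : ℝ) < (1 / 2 : ℝ) ^ n := by positivity
    set g : ℝ → ℝ × ℝ := fun θ => (Real.cos θ, Real.sin θ) with hg
    have htb : TotallyBounded (Set.range g) := by
      refine (isCompact_closedBall (0 : ℝ × ℝ) 1).totallyBounded.subset ?_
      rintro _ ⟨θ, rfl⟩
      simp [hg, Prod.norm_def, Real.abs_cos_le_one, Real.abs_sin_le_one]
    obtain ⟨t, hts, htf, hcov⟩ := Metric.finite_approx_of_totallyBounded htb _ hε
    obtain ⟨s, hs⟩ : ∃ s : Finset ℝ, g '' (s : Set ℝ) = t := by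
      classical
      choose! k hk using fun w (hw : w ∈ t) => hts hw
      refine ⟨htf.toFinset.image k, ?_⟩
      ext w
      constructor
      · rintro ⟨θ, hθ, rfl⟩
        simp only [Finset.coe_image, Set.Finite.coe_toFinset, Set.mem_image] at hθ
        obtain ⟨w, hw, rfl⟩ := hθ
        rw [hk w hw]
        exact hw
      · intro hw
        refine ⟨k w, ?_, hk w hw⟩
        rw [Finset.coe_image, Set.Finite.coe_toFinset]
        exact Set.mem_image_of_mem k hw
    have key : ∀ θ : ℝ, ∃ φ ∈ s, f θ ≤ f φ + ((1 / 2 : ℝ) ^ n) • u := by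
      intro θ
      have := hcov ⟨θ, rfl⟩
      simp only [Set.mem_iUnion] at this
      obtain ⟨w, hw, hd⟩ := this
      rw [← hs] at hw
      obtain ⟨φ, hφ, rfl⟩ := hw
      refine ⟨φ, hφ, ?_⟩
      rw [Metric.mem_ball, Prod.dist_eq, max_lt_iff, Real.dist_eq, Real.dist_eq] at hd
      have h1 := hsm _ _ x hd.1.le
      have h2 := hsm _ _ y hd.2.le
      have h3 := add_le_add h1 h2
      rw [← smul_add] at h3
      have h4 := add_le_add_right h3 (f φ)
      refine le_trans (le_of_eq ?_) h4
      simp only [hf, hg]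
      module
    obtain ⟨φ, hφ, -⟩ := key 0
    exact ⟨s, ⟨φ, hφ⟩, key⟩
  choose t htn ht using hnet
  set s : ℕ → E := fun n => (t n).sup' (htn n) f with hs
  have hub : ∀ n θ, f θ ≤ s n + ((1 / 2 : ℝ) ^ n) • u := by
    intro n θ
    obtain ⟨φ, hφ, h⟩ := ht n θ
    exact h.trans (by gcongr; exact Finset.le_sup' f hφ)
  have hss : ∀ n m, s n ≤ s m + ((1 / 2 : ℝ) ^ m) • u := fun n m =>
    Finset.sup'_le _ _ fun θ _ => hub m θ
  have hle : ∀ n, ‖s n - s (n + 1)‖ ≤ ‖u‖ * (1 / 2 : ℝ) ^ n := by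
    intro n
    have h1 : |s n - s (n + 1)| ≤ |((1 / 2 : ℝ) ^ n) • u| := by
      have hp : (0 : E) ≤ ((1 / 2 : ℝ) ^ n) • u := smul_nonneg (by positivity) hu0
      rw [abs_of_nonneg hp]
      refine sup_le ?_ ?_
      · rw [sub_le_iff_le_add']
        refine (hss n (n + 1)).trans ?_
        refine add_le_add le_rfl (smul_le_smul_of_nonneg_right ?_ hu0)
        exact pow_le_pow_of_le_one (by norm_num) (by norm_num) (Nat.le_succ n)
      · rw [neg_sub, sub_le_iff_le_add']
        exact hss (n + 1) n
    have h2 := norm_le_norm_of_abs_le_abs h1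
    rw [norm_smul, Real.norm_of_nonneg (by positivity)] at h2
    linarith
  have hcau : CauchySeq s := by
    refine cauchySeq_of_le_geometric (1 / 2) ‖u‖ (by norm_num) fun n => ?_
    rw [dist_eq_norm]
    exact hle n
  obtain ⟨m, hm⟩ := cauchySeq_tendsto_of_complete hcau
  refine ⟨m, ?_, ?_⟩
  · rintro _ ⟨θ, rfl⟩
    have hlim : Filter.Tendsto (fun n => s n + ((1 / 2 : ℝ) ^ n) • u) Filter.atTop
        (nhds (m + (0 : ℝ) • u)) :=
      hm.add ((tendsto_pow_atTop_nhds_zero_of_lt_one (by norm_num) (by norm_num)).smul_const u)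
    rw [zero_smul, add_zero] at hlim
    exact ge_of_tendsto' hlim fun n => hub n θ
  · intro b hb
    exact le_of_tendsto' hm fun n => Finset.sup'_le _ _ fun θ _ => hb ⟨θ, rfl⟩

/-- The modulus `|x + iy| = sup_θ ((cos θ) x + (sin θ) y)`, an element of `E`. -/
def modulus (z : Complexification E) : E := Classical.choose (exists_isLUB z)

theorem isLUB_modulus (z : Complexification E) :
    IsLUB (Set.range fun θ : ℝ => Real.cos θ • z.re + Real.sin θ • z.im) (modulus z) :=
  Classical.choose_spec (exists_isLUB z)

/-- The norm of a complex Banach lattice, `‖z‖ = ‖ |z| ‖`. -/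
instance : Norm (Complexification E) := ⟨fun z => ‖modulus z‖⟩

/-- The lower `q`-estimate in the complexification of `E`. -/
def LowerEstimate (E : Type*) [NormedAddCommGroup E] [NormedSpace ℝ E] [CompleteSpace E]
    [Lattice E] [IsOrderedAddMonoid E] [IsOrderedModule ℝ E] [HasSolidNorm E] (q : ℝ) : Prop :=
  ∃ C : ℝ, 0 < C ∧ ∀ (n : ℕ) (x : Fin n → Complexification E),
    (∀ i j, i ≠ j → modulus (x i) ⊓ modulus (x j) = 0) →
      (∑ i, ‖x i‖ ^ q) ^ (1 / q) ≤ C * ‖∑ i, x i‖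

/-- `p` is a complex norm equivalent to the given one, and it is solid, so that the
complexification with the norm `p` and the same order is again a complex Banach lattice. -/
structure IsEquivLatticeNorm (p : Seminorm ℂ (Complexification E)) : Prop where
  equiv : ∃ a b : ℝ, 0 < a ∧ 0 < b ∧ ∀ z, a * ‖z‖ ≤ p z ∧ p z ≤ b * ‖z‖
  solid : ∀ z w : Complexification E, modulus z ≤ modulus w → p z ≤ p w

end Complexification

end BanachLattice

end

/-! From (ii) to (i): property (C) with `c = 1` gives `ρ > 1` such that a sum of two disjoint
positive elements of norm at least `t` has norm at least `ρ * t`. Repeated halving gives norm at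
least `ρ ^ m * t` for `2 ^ m` such elements. With `ρ ^ r = 2` this is a weak lower `r`-estimate
(`exists_card_mul_rpow_le`): the `k`-th largest term satisfies `p x ^ r ≤ 2 P / k`, where `P` is the
`r`-th power of the norm of the whole sum. Since `∑ 1 / k ^ 2` converges, a lower estimate with
exponent `2 r` follows.

From (i) to (ii): the exponent may be raised, so let `q ≥ 1`. The new norm of `u` is the supremum of
`(∑ ‖x i‖ ^ q) ^ (1 / q)` over disjoint positive families with sum below `|u|`. The lower estimate
makes it finite and equivalent to the old norm, Riesz decomposition and Minkowski's inequality give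
the triangle inequality, and its `q`-th power is superadditive on disjoint elements
(`energy_add_energy_le`), which gives (C).

The complex case reduces to the real one through the modulus, a lattice-valued seminorm. -/

namespace BanachLattice

/-! ### Disjoint elements of vector lattices. -/

section Disjoint

theorem inf_eq_zero_of_le {E : Type*} [Lattice E] [Zero E] {x y x' y' : E} (hx' : 0 ≤ x') (hy' : 0 ≤ y') (hx : x' ≤ x)
    (hy : y' ≤ y) (h : x ⊓ y = 0) : x' ⊓ y' = 0 :=
  le_antisymm ((inf_le_inf hx hy).trans h.le) (le_inf hx' hy')

variable {E : Type*} [AddCommGroup E] [Lattice E] [IsOrderedAddMonoid E]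

theorem inf_add_eq_zero {w x y : E} (hw : 0 ≤ w) (hx : 0 ≤ x) (hy : 0 ≤ y)
    (hwx : w ⊓ x = 0) (hwy : w ⊓ y = 0) : w ⊓ (x + y) = 0 := by
  refine le_antisymm ?_ (le_inf hw (add_nonneg hx hy))
  have h : w ⊓ (x + y) - y ≤ w ⊓ x :=
    le_inf ((sub_le_self _ hy).trans inf_le_left) (sub_le_iff_le_add.2 inf_le_right)
  rw [hwx, sub_nonpos] at h
  exact (le_inf inf_le_left h).trans hwy.le

theorem inf_sum_eq_zero {ι : Type*} {w : E} (hw : 0 ≤ w) (s : Finset ι) (x : ι → E)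
    (hx : ∀ i ∈ s, 0 ≤ x i) (hwx : ∀ i ∈ s, w ⊓ x i = 0) : w ⊓ ∑ i ∈ s, x i = 0 := by
  classical
  induction s using Finset.induction_on with
  | empty => simpa using hw
  | insert a s ha ih =>
    rw [Finset.forall_mem_insert] at hx hwx
    rw [Finset.sum_insert ha]
    exact inf_add_eq_zero hw hx.1 (Finset.sum_nonneg hx.2) hwx.1 (ih hx.2 hwx.2)

theorem sum_inf_sum_eq_zero {ι κ : Type*} (s : Finset ι) (t : Finset κ) (x : ι → E) (y : κ → E)
    (hx : ∀ i ∈ s, 0 ≤ x i) (hy : ∀ j ∈ t, 0 ≤ y j) (h : ∀ i ∈ s, ∀ j ∈ t, x i ⊓ y j = 0) :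
    (∑ i ∈ s, x i) ⊓ ∑ j ∈ t, y j = 0 := by
  refine inf_sum_eq_zero (Finset.sum_nonneg hx) t y hy fun j hj => ?_
  rw [inf_comm]
  exact inf_sum_eq_zero (hy j hj) s x hx fun i hi => by rw [inf_comm, h i hi j hj]

/-- For disjoint positive elements the sum is the supremum. -/
theorem sum_le_of_disjoint {ι : Type*} {u : E} (hu : 0 ≤ u) (s : Finset ι) (x : ι → E)
    (hx : ∀ i ∈ s, 0 ≤ x i) (hxu : ∀ i ∈ s, x i ≤ u)
    (h : ∀ i ∈ s, ∀ j ∈ s, i ≠ j → x i ⊓ x j = 0) : ∑ i ∈ s, x i ≤ u := by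
  classical
  induction s using Finset.induction_on with
  | empty => simpa using hu
  | insert a s ha ih =>
    rw [Finset.forall_mem_insert] at hx hxu
    have h0 : x a ⊓ ∑ i ∈ s, x i = 0 := inf_sum_eq_zero hx.1 s x hx.2 fun i hi =>
      h a (Finset.mem_insert_self _ _) i (Finset.mem_insert_of_mem hi) (by grind)
    rw [Finset.sum_insert ha, ← inf_add_sup, h0, zero_add]
    exact sup_le hxu.1 (ih hx.2 hxu.2 fun i hi j hj =>
      h i (Finset.mem_insert_of_mem hi) j (Finset.mem_insert_of_mem hj))

/-- A lattice-valued seminorm is superadditive on disjoint elements. -/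
theorem sum_le_apply_sum_of_disjoint {F ι : Type*} [AddCommGroup F] {m : F → E} (h0 : m 0 = 0)
    (hnonneg : ∀ x, 0 ≤ m x) (hadd : ∀ x y, m (x + y) ≤ m x + m y) (hneg : ∀ x, m (-x) = m x)
    (s : Finset ι) (x : ι → F) (h : ∀ i ∈ s, ∀ j ∈ s, i ≠ j → m (x i) ⊓ m (x j) = 0) :
    ∑ i ∈ s, m (x i) ≤ m (∑ i ∈ s, x i) := by
  classical
  have hsub : ∀ a b, m a - m b ≤ m (a + b) := fun a b => by
    have := hadd (a + b) (-b)
    rw [add_neg_cancel_right, hneg] at this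
    exact sub_le_iff_le_add.2 this
  have htwo : ∀ a b, m a ⊓ m b = 0 → m a + m b ≤ m (a + b) := fun a b hab => by
    -- With vanishing infimum, the sum equals sup minus inf, that is `|m a - m b|`, and the reverse
    -- triangle inequality bounds this.
    rw [← inf_add_sup, hab, zero_add, ← sub_zero (m a ⊔ m b), ← hab, sup_sub_inf_eq_abs_sub]
    refine abs_le'.2 ⟨?_, ?_⟩
    · rw [add_comm a b]
      exact hsub b a
    · rw [neg_sub]
      exact hsub a b
  induction s using Finset.induction_on with
  | empty => simp [h0]
  | insert a s ha ih =>
    have hs := ih fun i hi j hj =>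
      h i (Finset.mem_insert_of_mem hi) j (Finset.mem_insert_of_mem hj)
    rw [Finset.sum_insert ha, Finset.sum_insert ha]
    refine (add_le_add le_rfl hs).trans (htwo _ _ ?_)
    refine inf_eq_zero_of_le (hnonneg _) (hnonneg _) le_rfl
      (Finset.le_sum_of_subadditive m h0.le hadd s x) ?_
    exact inf_sum_eq_zero (hnonneg _) s _ (fun i _ => hnonneg _) fun i hi =>
      h a (Finset.mem_insert_self _ _) i (Finset.mem_insert_of_mem hi) (by grind)

end Disjoint

section Smul

variable {E : Type*} [AddCommGroup E] [Lattice E] [Module ℝ E] [IsOrderedModule ℝ E]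

theorem smul_inf_smul_eq_zero {x y : E} {r : ℝ} (hr : 0 ≤ r) (hx : 0 ≤ x) (hy : 0 ≤ y)
    (h : x ⊓ y = 0) : r • x ⊓ r • y = 0 := by
  rcases hr.eq_or_lt with rfl | hr
  · simp
  refine le_antisymm ?_ (le_inf (smul_nonneg hr.le hx) (smul_nonneg hr.le hy))
  have h1 : r⁻¹ • (r • x ⊓ r • y) ≤ x ⊓ y := by
    refine le_inf ?_ ?_
    · simpa [smul_smul, hr.ne'] using
        smul_le_smul_of_nonneg_left (inf_le_left : r • x ⊓ r • y ≤ _) (inv_nonneg.2 hr.le)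
    · simpa [smul_smul, hr.ne'] using
        smul_le_smul_of_nonneg_left (inf_le_right : r • x ⊓ r • y ≤ _) (inv_nonneg.2 hr.le)
  have h2 := smul_le_smul_of_nonneg_left h1 hr.le
  rwa [h, smul_zero, smul_smul, mul_inv_cancel₀ hr.ne', one_smul] at h2

theorem abs_smul_le (r : ℝ) (x : E) : |r • x| ≤ |r| • |x| := by
  have key : ∀ (r : ℝ), r • x ≤ |r| • |x| := fun r => by
    rcases le_total 0 r with h | h
    · rw [abs_of_nonneg h]
      exact smul_le_smul_of_nonneg_left (le_abs_self x) h
    · rw [abs_of_nonpos h, ← neg_smul_neg r x]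
      exact smul_le_smul_of_nonneg_left (neg_le_abs x) (neg_nonneg.2 h)
  refine abs_le'.2 ⟨key r, ?_⟩
  rw [← neg_smul, ← abs_neg r]
  exact key _

end Smul

/-! ### From property (C) to a lower estimate. -/

namespace IsEquivLatticeNorm

variable {E : Type*} [NormedAddCommGroup E] [NormedSpace ℝ E] [Lattice E]
  [IsOrderedAddMonoid E] {p : Seminorm ℝ E}

theorem apply_abs (hp : IsEquivLatticeNorm p) (x : E) : p |x| = p x :=
  le_antisymm (hp.solid _ _ (abs_abs x).le) (hp.solid _ _ (abs_abs x).ge)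

theorem mono (hp : IsEquivLatticeNorm p) {x y : E} (hx : 0 ≤ x) (h : x ≤ y) : p x ≤ p y :=
  hp.solid _ _ (by rwa [abs_of_nonneg hx, abs_of_nonneg (hx.trans h)])

/-- Halving the family gains one factor `ρ` at each level, since the two half-sums are again
disjoint. -/
theorem pow_mul_le_apply_sum (hp : IsEquivLatticeNorm p) {ρ : ℝ} (hρ : 1 < ρ)
    (H : ∀ (t : ℝ) (y z : E), 0 ≤ t → 0 ≤ y → 0 ≤ z → y ⊓ z = 0 →
      t ≤ p y → t ≤ p z → ρ * t ≤ p (y + z))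
    {ι : Type*} {x : ι → E} (hx : ∀ i, 0 ≤ x i) (hd : ∀ i j, i ≠ j → x i ⊓ x j = 0)
    {t : ℝ} (ht : 0 ≤ t) (m : ℕ) (s : Finset ι) (hm : 2 ^ m ≤ s.card)
    (hs : ∀ i ∈ s, t ≤ p (x i)) : ρ ^ m * t ≤ p (∑ i ∈ s, x i) := by
  classical
  induction m generalizing s with
  | zero =>
    obtain ⟨i, hi⟩ := Finset.card_pos.1 (by simpa using hm : 0 < s.card)
    rw [pow_zero, one_mul]
    exact (hs i hi).trans (hp.mono (hx i) (Finset.single_le_sum (fun j _ => hx j) hi))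
  | succ m ih =>
    rw [pow_succ] at hm
    obtain ⟨u, hus, hu⟩ := Finset.exists_subset_card_eq (by omega : 2 ^ m ≤ s.card)
    have hv : 2 ^ m ≤ (s \ u).card := by
      rw [Finset.card_sdiff_of_subset hus]
      omega
    rw [← Finset.sum_sdiff hus, pow_succ', mul_assoc]
    refine H _ _ _ (by positivity) (Finset.sum_nonneg fun i _ => hx i)
      (Finset.sum_nonneg fun i _ => hx i) ?_ (ih _ hv fun i hi => hs i (Finset.sdiff_subset hi))
      (ih _ hu.ge fun i hi => hs i (hus hi))
    refine sum_inf_sum_eq_zero _ _ _ _ (fun i _ => hx i) (fun i _ => hx i) fun i hi j hj => ?_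
    exact hd i j fun hij => (Finset.mem_sdiff.1 hi).2 (hij ▸ hj)

variable [IsOrderedModule ℝ E]

/-- Homogeneous form of (C) for `c = 1`: rescaling makes the element of smaller norm a unit vector.
-/
theorem exists_mul_le_of_propertyC (hC : PropertyC fun x : E => p x) :
    ∃ ρ : ℝ, 1 < ρ ∧ ∀ (t : ℝ) (y z : E), 0 ≤ t → 0 ≤ y → 0 ≤ z → y ⊓ z = 0 →
      t ≤ p y → t ≤ p z → ρ * t ≤ p (y + z) := by
  obtain ⟨δ, hδ, H⟩ := hC 1 one_pos
  have hle : ∀ (t : ℝ) (y z : E), 0 ≤ t → 0 ≤ y → 0 ≤ z → y ⊓ z = 0 →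
      t ≤ p y → p y ≤ p z → (1 + δ) * t ≤ p (y + z) := by
    intro t y z ht hy hz hyz hty hpyz
    rcases (apply_nonneg p y).eq_or_lt with h0 | h0
    · have : t = 0 := le_antisymm (h0 ▸ hty) ht
      simp [this]
    have hi : 0 ≤ (p y)⁻¹ := inv_nonneg.2 h0.le
    have hsc : ∀ w, p ((p y)⁻¹ • w) = (p y)⁻¹ * p w := fun w => by
      rw [map_smul_eq_mul, Real.norm_of_nonneg hi]
    have := H _ _ _ (add_nonneg (smul_nonneg hi hy) (smul_nonneg hi hz)) (smul_nonneg hi hy)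
      (smul_nonneg hi hz) rfl (smul_inf_smul_eq_zero hi hy hz hyz)
      ((hsc y).trans (inv_mul_cancel₀ h0.ne'))
      ((inv_mul_cancel₀ h0.ne').ge.trans ((by gcongr : _ ≤ _ * p z).trans (hsc z).ge))
    simp only [← smul_add] at this
    rw [hsc, inv_mul_eq_div, le_div_iff₀ h0] at this
    exact (by gcongr : (1 + δ) * t ≤ (1 + δ) * p y).trans this
  refine ⟨1 + δ, by linarith, fun t y z ht hy hz hyz hty htz => ?_⟩
  rcases le_total (p y) (p z) with h | h
  · exact hle t y z ht hy hz hyz hty h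
  · rw [add_comm y z]
    exact hle t z y ht hz hy (by rw [inf_comm, hyz]) htz h

theorem exists_card_mul_rpow_le (hp : IsEquivLatticeNorm p) (hC : PropertyC fun x : E => p x) :
    ∃ r : ℝ, 0 < r ∧ ∀ {ι : Type} (x : ι → E), (∀ i, 0 ≤ x i) →
      (∀ i j, i ≠ j → x i ⊓ x j = 0) → ∀ (t : ℝ), 0 ≤ t → ∀ s : Finset ι,
      (∀ i ∈ s, t ≤ p (x i)) → s.card * t ^ r ≤ 2 * p (∑ i ∈ s, x i) ^ r := by
  obtain ⟨ρ, hρ, H⟩ := exists_mul_le_of_propertyC hC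
  have hρ0 : 0 < ρ := by linarith
  have hr : 0 < Real.logb ρ 2 := Real.logb_pos hρ (by norm_num)
  -- This exponent turns `ρ ^ m` into `2 ^ m`; the factor 2 in the bound pays for rounding the
  -- cardinality down to a power of two.
  refine ⟨Real.logb ρ 2, hr, fun x hx hd t ht s hs => ?_⟩
  rcases s.eq_empty_or_nonempty with rfl | hne
  · simp [Real.zero_rpow hr.ne']
  have hm := hp.pow_mul_le_apply_sum hρ H hx hd ht (Nat.log 2 s.card) s
    (Nat.pow_log_le_self 2 (Finset.card_pos.2 hne).ne') hs
  have hc : (s.card : ℝ) ≤ 2 * 2 ^ Nat.log 2 s.card := by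
    rw [← pow_succ']
    exact_mod_cast (Nat.lt_pow_succ_log_self one_lt_two _).le
  have h1 := Real.rpow_le_rpow (by positivity) hm hr.le
  rw [Real.mul_rpow (by positivity) ht, ← Real.rpow_pow_comm hρ0.le,
    Real.rpow_logb hρ0 hρ.ne' two_pos] at h1
  calc (s.card : ℝ) * t ^ Real.logb ρ 2
      ≤ 2 * 2 ^ Nat.log 2 s.card * t ^ Real.logb ρ 2 := by gcongr
    _ ≤ _ := by linarith

theorem exists_sum_rpow_le (hp : IsEquivLatticeNorm p) (hC : PropertyC fun x : E => p x) :
    ∃ q : ℝ, 0 < q ∧ ∀ (n : ℕ) (x : Fin n → E), (∀ i, 0 ≤ x i) →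
      (∀ i j, i ≠ j → x i ⊓ x j = 0) → ∑ i, p (x i) ^ q ≤ 8 * p (∑ i, x i) ^ q := by
  obtain ⟨r, hr, H⟩ := hp.exists_card_mul_rpow_le hC
  -- Doubling the exponent turns the divergent bound `1 / k` on the terms into the summable `1 / k ^
  -- 2`.
  refine ⟨r * (2 : ℕ), by positivity, fun n x hx hd => ?_⟩
  simp only [Real.rpow_mul_natCast (apply_nonneg p _)]
  set P := p (∑ i, x i) ^ r with hP
  have hP0 : 0 ≤ P := by positivity
  -- Elements enter in order of decreasing norm, so the new one is the smallest and the weak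
  -- estimate bounds it. The right side telescopes: `1 / (k + 1) ^ 2 ≤ 2 / (k + 1) - 2 / (k + 2)`.
  have key : ∀ s : Finset (Fin n),
      ∑ i ∈ s, (p (x i) ^ r) ^ 2 ≤ 4 * P ^ 2 * (2 - 2 / ((s.card : ℝ) + 1)) := by
    intro s
    refine Finset.induction_on_max_value (fun i => -p (x i)) s ?_ ?_
    · simp
    · intro a s ha hmax ih
      have h1 := H x hx hd (p (x a)) (apply_nonneg _ _) (insert a s) fun i hi => by
        rcases Finset.mem_insert.1 hi with rfl | hi
        · exact le_rfl
        · exact neg_le_neg_iff.1 (hmax i hi)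
      have h2 : p (∑ i ∈ insert a s, x i) ^ r ≤ P :=
        Real.rpow_le_rpow (apply_nonneg _ _) (hp.mono (Finset.sum_nonneg fun i _ => hx i)
          (Finset.sum_le_sum_of_subset_of_nonneg (Finset.subset_univ _) fun i _ _ => hx i)) hr.le
      rw [Finset.sum_insert ha]
      rw [Finset.card_insert_of_notMem ha] at h1 ⊢
      push_cast at h1 ⊢
      set k : ℝ := (s.card : ℝ) with hk
      have hk0 : 0 ≤ k := Nat.cast_nonneg _
      have h3 : p (x a) ^ r ≤ 2 * P / (k + 1) := by
        rw [le_div_iff₀ (by positivity)]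
        linarith
      have h4 : (p (x a) ^ r) ^ 2 ≤ (2 * P / (k + 1)) ^ 2 := by gcongr
      have h5 : (2 * P / (k + 1)) ^ 2 + 4 * P ^ 2 * (2 - 2 / (k + 1))
          = 4 * P ^ 2 * (1 / (k + 1) ^ 2 + 2 - 2 / (k + 1)) := by
        field_simp
        ring
      refine (add_le_add h4 ih).trans (h5.le.trans ?_)
      refine mul_le_mul_of_nonneg_left ?_ (by positivity)
      have h6 : 2 - 2 / (k + 1 + 1) - (1 / (k + 1) ^ 2 + 2 - 2 / (k + 1))
          = k / ((k + 1) ^ 2 * (k + 1 + 1)) := by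
        field_simp
        ring
      have : 0 ≤ k / ((k + 1) ^ 2 * (k + 1 + 1)) := by positivity
      linarith
  refine (key Finset.univ).trans ?_
  have : 0 ≤ 2 / (((Finset.univ : Finset (Fin n)).card : ℝ) + 1) := by positivity
  nlinarith [sq_nonneg P]

theorem exists_lowerEstimate (hp : IsEquivLatticeNorm p) (hC : PropertyC fun x : E => p x)
    [HasSolidNorm E] : ∃ q : ℝ, 0 < q ∧ LowerEstimate E q := by
  obtain ⟨q, hq, H⟩ := hp.exists_sum_rpow_le hC
  obtain ⟨a, b, ha, hb, hab⟩ := hp.equiv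
  refine ⟨q, hq, (8 : ℝ) ^ q⁻¹ * (b / a), by positivity, fun n x hd => ?_⟩
  rw [one_div, Real.rpow_inv_le_iff_of_pos (by positivity) (by positivity) hq]
  have h1 := H n (fun i => |x i|) (fun i => abs_nonneg _) hd
  have h2 : p (∑ i, |x i|) ≤ b * ‖∑ i, x i‖ := by
    -- Superadditivity of the modulus on disjoint elements reduces arbitrary elements to positive
    -- ones.
    have h := sum_le_apply_sum_of_disjoint (m := fun x : E => |x|) abs_zero abs_nonneg
      abs_add_le abs_neg Finset.univ x fun i _ j _ => hd i j
    exact (hp.mono (Finset.sum_nonneg fun i _ => abs_nonneg _) h).trans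
      ((hp.apply_abs _).le.trans (hab _).2)
  calc ∑ i, ‖x i‖ ^ q ≤ ∑ i, (a⁻¹ * p |x i|) ^ q := by
        gcongr with i
        rw [hp.apply_abs, inv_mul_eq_div, le_div_iff₀' ha]
        exact (hab _).1
    _ = (a⁻¹) ^ q * ∑ i, p |x i| ^ q := by
        rw [Finset.mul_sum]
        exact Finset.sum_congr rfl fun i _ => Real.mul_rpow (by positivity) (apply_nonneg _ _)
    _ ≤ (a⁻¹) ^ q * (8 * (b * ‖∑ i, x i‖) ^ q) := by
        gcongr
        exact h1.trans (by gcongr)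
    _ = _ := by
        rw [Real.mul_rpow (by positivity) (by positivity), Real.mul_rpow (by positivity)
          (by positivity), Real.mul_rpow (by positivity) (by positivity),
          Real.rpow_inv_rpow (by norm_num) hq.ne', div_eq_mul_inv,
          Real.mul_rpow (by positivity) (by positivity)]
        ring

end IsEquivLatticeNorm

end BanachLattice

namespace BanachLattice

/-! ### From a lower estimate to a norm with property (C). -/

section Energy

variable {E : Type*} [NormedAddCommGroup E] [Lattice E]

/-- The `x i` are positive and mutually disjoint, and their sum is at most `u`. -/
def IsDisjointBelow {ι : Type*} [Fintype ι] (x : ι → E) (u : E) : Prop :=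
  (∀ i, 0 ≤ x i) ∧ (∀ i j, i ≠ j → x i ⊓ x j = 0) ∧ ∑ i, x i ≤ u

/-- The values `∑ ‖x i‖ ^ q` over the finite disjoint positive families with sum at most `|u|`. -/
def energySet (q : ℝ) (u : E) : Set ℝ :=
  {r | ∃ (n : ℕ) (x : Fin n → E), IsDisjointBelow x |u| ∧ ∑ i, ‖x i‖ ^ q = r}

/-- The supremum of `∑ ‖x i‖ ^ q` over the finite disjoint positive families with sum at most
`|u|`. -/
noncomputable def energy (q : ℝ) (u : E) : ℝ := sSup (energySet q u)

/-- Frees the index type, so that singletons and concatenated families can serve as competitors. -/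
theorem sum_mem_energySet (q : ℝ) {u : E} {ι : Type*} [Fintype ι] {x : ι → E}
    (hx : IsDisjointBelow x |u|) : ∑ i, ‖x i‖ ^ q ∈ energySet q u := by
  let e := (Fintype.equivFin ι).symm
  refine ⟨Fintype.card ι, x ∘ e, ⟨fun i => hx.1 _, fun i j h => hx.2.1 _ _ fun h' => h
    (e.injective h'), ?_⟩, ?_⟩
  · exact (Equiv.sum_comp e x).le.trans hx.2.2
  · exact Equiv.sum_comp e fun i => ‖x i‖ ^ q

variable [IsOrderedAddMonoid E]

theorem zero_mem_energySet (q : ℝ) (u : E) : 0 ∈ energySet q u :=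
  ⟨0, Fin.elim0, ⟨fun i => i.elim0, fun i => i.elim0, by simp⟩, by simp⟩

theorem energy_nonneg (q : ℝ) (u : E) : 0 ≤ energy q u := by
  by_cases h : BddAbove (energySet q u)
  · exact le_csSup h (zero_mem_energySet q u)
  -- The supremum of an unbounded set of reals is 0 by convention.
  · exact (Real.sSup_of_not_bddAbove h).ge

theorem energy_le {q : ℝ} {u : E} {M : ℝ} (h : ∀ (n : ℕ) (x : Fin n → E),
    IsDisjointBelow x |u| → ∑ i, ‖x i‖ ^ q ≤ M) : energy q u ≤ M :=
  csSup_le ⟨0, zero_mem_energySet q u⟩ (by rintro _ ⟨n, x, hx, rfl⟩; exact h n x hx)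

variable {q : ℝ}

theorem norm_rpow_le_energy (hbdd : ∀ u : E, BddAbove (energySet q u)) (u : E) [HasSolidNorm E] :
    ‖u‖ ^ q ≤ energy q u := by
  refine le_csSup (hbdd u) ?_
  have h := sum_mem_energySet q (x := fun _ : Unit => |u|) (u := u)
    ⟨fun _ => abs_nonneg u, fun i j h => (h rfl).elim, by simp⟩
  simpa only [Finset.univ_unique, Finset.sum_singleton, norm_abs_eq_norm] using h

theorem energy_mono (hbdd : ∀ u : E, BddAbove (energySet q u)) {u v : E} (h : |u| ≤ |v|) :
    energy q u ≤ energy q v :=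
  energy_le fun _ _ hx => le_csSup (hbdd v) (sum_mem_energySet q ⟨hx.1, hx.2.1, hx.2.2.trans h⟩)

/-- A family below `y` and one below `z` concatenate to a disjoint family below `y + z`. -/
theorem energy_add_energy_le (hbdd : ∀ u : E, BddAbove (energySet q u)) {y z : E} (hy : 0 ≤ y)
    (hz : 0 ≤ z) (h : y ⊓ z = 0) : energy q y + energy q z ≤ energy q (y + z) := by
  rw [← le_sub_iff_add_le]
  refine energy_le fun n a ha => ?_
  rw [le_sub_comm]
  refine energy_le fun k b hb => ?_
  rw [le_sub_iff_add_le']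
  rw [abs_of_nonneg hy] at ha
  rw [abs_of_nonneg hz] at hb
  have hay : ∀ i, a i ≤ y := fun i =>
    (Finset.single_le_sum (fun j _ => ha.1 j) (Finset.mem_univ i)).trans ha.2.2
  have hbz : ∀ i, b i ≤ z := fun i =>
    (Finset.single_le_sum (fun j _ => hb.1 j) (Finset.mem_univ i)).trans hb.2.2
  have hab : ∀ i j, a i ⊓ b j = 0 := fun i j =>
    inf_eq_zero_of_le (ha.1 i) (hb.1 j) (hay i) (hbz j) h
  have hm := sum_mem_energySet q (x := Sum.elim a b) (u := y + z) ⟨?_, ?_, ?_⟩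
  · rw [Fintype.sum_sum_type] at hm
    exact le_csSup (hbdd _) hm
  · rintro (i | i)
    exacts [ha.1 i, hb.1 i]
  · rintro (i | i) (j | j) hij
    · exact ha.2.1 i j fun h => hij (h ▸ rfl)
    · exact hab i j
    · exact (inf_comm _ _).trans (hab j i)
    · exact hb.2.1 i j fun h => hij (h ▸ rfl)
  · rw [Fintype.sum_sum_type, abs_of_nonneg (add_nonneg hy hz)]
    exact add_le_add ha.2.2 hb.2.2

/-- Each `x i` below `|u| + |v|` splits into `x i ⊓ |u|` and a remainder below `|v|`. Both families
of pieces stay disjoint, so termwise bounds also bound their sums; Minkowski's inequality then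
combines them. -/
theorem energy_add_rpow_le (hbdd : ∀ u : E, BddAbove (energySet q u)) (hq : 1 ≤ q) (u v : E) :
    energy q (u + v) ^ q⁻¹ ≤ energy q u ^ q⁻¹ + energy q v ^ q⁻¹ := by
  have hq0 : 0 < q := one_pos.trans_le hq
  have hu := Real.rpow_nonneg (energy_nonneg q u) q⁻¹
  have hv := Real.rpow_nonneg (energy_nonneg q v) q⁻¹
  rw [Real.rpow_inv_le_iff_of_pos (energy_nonneg q _) (add_nonneg hu hv) hq0]
  refine energy_le fun n x hx => ?_
  have hxle : ∀ i, x i ≤ |u| + |v| := fun i =>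
    (Finset.single_le_sum (fun j _ => hx.1 j) (Finset.mem_univ i)).trans
      (hx.2.2.trans (abs_add_le u v))
  have hbelow : ∀ (a : Fin n → E) (w : E), (∀ i, 0 ≤ a i) → (∀ i, a i ≤ x i) →
      (∀ i, a i ≤ |w|) → (∑ i, ‖a i‖ ^ q) ^ q⁻¹ ≤ energy q w ^ q⁻¹ := by
    intro a w h0 hax haw
    have hd : ∀ i j, i ≠ j → a i ⊓ a j = 0 := fun i j hij =>
      inf_eq_zero_of_le (h0 i) (h0 j) (hax i) (hax j) (hx.2.1 i j hij)
    refine Real.rpow_le_rpow (by positivity) (le_csSup (hbdd w) (sum_mem_energySet q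
      ⟨h0, hd, ?_⟩)) (inv_nonneg.2 hq0.le)
    exact sum_le_of_disjoint (abs_nonneg w) _ a (fun i _ => h0 i) (fun i _ => haw i)
      fun i _ j _ => hd i j
  have ha := hbelow (fun i => x i ⊓ |u|) u (fun i => le_inf (hx.1 i) (abs_nonneg u))
    (fun i => inf_le_left) fun i => inf_le_right
  have hb := hbelow (fun i => x i - x i ⊓ |u|) v (fun i => sub_nonneg.2 inf_le_left)
    (fun i => sub_le_self _ (le_inf (hx.1 i) (abs_nonneg u))) fun i => by
      rw [sub_le_comm]
      exact le_inf (sub_le_self _ (abs_nonneg v)) (sub_le_iff_le_add.2 (hxle i))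
  have hmink := Real.Lp_add_le_of_nonneg Finset.univ (f := fun i => ‖x i ⊓ |u|‖)
    (g := fun i => ‖x i - x i ⊓ |u|‖) hq (fun i _ => norm_nonneg _) fun i _ => norm_nonneg _
  rw [one_div] at hmink
  rw [← Real.rpow_inv_le_iff_of_pos (by positivity) (add_nonneg hu hv) hq0]
  refine le_trans ?_ (hmink.trans (add_le_add ha hb))
  gcongr with i
  exact (norm_add_le (x i ⊓ |u|) (x i - x i ⊓ |u|)).trans' (by rw [add_sub_cancel])

theorem energy_zero (hq : 0 < q) : energy q (0 : E) = 0 := by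
  refine le_antisymm (energy_le fun n x hx => Finset.sum_nonpos fun i _ => ?_)
    (energy_nonneg q _)
  have : x i = 0 := le_antisymm
    ((Finset.single_le_sum (fun j _ => hx.1 j) (Finset.mem_univ i)).trans
      (hx.2.2.trans abs_zero.le)) (hx.1 i)
  rw [this, norm_zero, Real.zero_rpow hq.ne']

variable [NormedSpace ℝ E] [IsOrderedModule ℝ E]

theorem energy_smul_rpow_le (hbdd : ∀ u : E, BddAbove (energySet q u)) (hq : 0 < q) (r : ℝ)
    (u : E) : energy q (r • u) ^ q⁻¹ ≤ ‖r‖ * energy q u ^ q⁻¹ := by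
  rcases eq_or_ne r 0 with rfl | hr
  · simp [energy_zero hq, hq.ne']
  have hr0 : 0 < |r| := abs_pos.2 hr
  have hi : 0 ≤ |r|⁻¹ := inv_nonneg.2 hr0.le
  have hu := Real.rpow_nonneg (energy_nonneg q u) q⁻¹
  rw [Real.norm_eq_abs, Real.rpow_inv_le_iff_of_pos (energy_nonneg q _) (by positivity) hq,
    Real.mul_rpow hr0.le hu, Real.rpow_inv_rpow (energy_nonneg q u) hq.ne']
  refine energy_le fun n x hx => ?_
  have hm := le_csSup (hbdd u) (sum_mem_energySet q (x := fun i => |r|⁻¹ • x i) (u := u)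
    ⟨fun i => smul_nonneg hi (hx.1 i),
      fun i j hij => smul_inf_smul_eq_zero hi (hx.1 i) (hx.1 j) (hx.2.1 i j hij), by
      rw [← Finset.smul_sum]
      refine (smul_le_smul_of_nonneg_left (hx.2.2.trans (abs_smul_le r u)) hi).trans_eq ?_
      rw [smul_smul, inv_mul_cancel₀ hr0.ne', one_smul]⟩)
  simp only [norm_smul, Real.norm_of_nonneg hi, Real.mul_rpow hi (norm_nonneg _)] at hm
  rwa [← Finset.mul_sum, Real.inv_rpow hr0.le, inv_mul_le_iff₀ (by positivity)] at hm

/-- The lattice norm `u ↦ (energy q u) ^ (1 / q)`. -/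
noncomputable def energySeminorm (hq : 1 ≤ q) (hbdd : ∀ u : E, BddAbove (energySet q u)) : Seminorm ℝ E :=
  Seminorm.ofSMulLE (fun u => energy q u ^ q⁻¹)
    (by simp [energy_zero (one_pos.trans_le hq), (one_pos.trans_le hq).ne'])
    (energy_add_rpow_le hbdd hq) (energy_smul_rpow_le hbdd (one_pos.trans_le hq))

theorem energySeminorm_apply (hq : 1 ≤ q) (hbdd : ∀ u : E, BddAbove (energySet q u)) (u : E) :
    energySeminorm hq hbdd u = energy q u ^ q⁻¹ := rfl

theorem propertyC_energySeminorm (hq : 1 ≤ q) (hbdd : ∀ u : E, BddAbove (energySet q u)) :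
    PropertyC fun u : E => energySeminorm hq hbdd u := by
  have hq0 : 0 < q := one_pos.trans_le hq
  intro c hc
  -- Superadditivity of the energy gives the norm of `y + z` a `q`-th power of at least `1 + c ^ q`.
  refine ⟨(1 + c ^ q) ^ q⁻¹ - 1, sub_pos.2 (Real.one_lt_rpow ?_ (inv_pos.2 hq0)), ?_⟩
  · have : 0 < c ^ q := Real.rpow_pos_of_pos hc q
    linarith
  rintro _ y z - hy hz rfl hyz h1 h2
  simp only [energySeminorm_apply] at h1 h2 ⊢
  rw [Real.rpow_inv_eq (energy_nonneg q y) zero_le_one hq0.ne',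
    Real.one_rpow] at h1
  rw [Real.le_rpow_inv_iff_of_pos hc.le (energy_nonneg q z) hq0] at h2
  rw [add_sub_cancel]
  refine Real.rpow_le_rpow (by positivity) ?_ (inv_nonneg.2 hq0.le)
  exact (add_le_add h1.ge h2).trans (energy_add_energy_le hbdd hy hz hyz)

end Energy

/-- The `ℓ^r` norm is at most the `ℓ^q` norm: every term is at most `S`, so `‖x i‖ ^ r ≤ ‖x i‖ ^ q *
S ^ (r - q)`. -/
theorem LowerEstimate.of_le {E : Type*} [NormedAddCommGroup E] [Lattice E] {q r : ℝ}
    (hq : 0 < q) (hqr : q ≤ r) (h : LowerEstimate E q) : LowerEstimate E r := by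
  obtain ⟨C, hC, H⟩ := h
  have hr : 0 < r := hq.trans_le hqr
  refine ⟨C, hC, fun n x hd => le_trans ?_ (H n x hd)⟩
  set S := (∑ i, ‖x i‖ ^ q) ^ (1 / q) with hS
  have hS0 : 0 ≤ S := by positivity
  have hSq : ∑ i, ‖x i‖ ^ q = S ^ q := by
    rw [hS, one_div, Real.rpow_inv_rpow (by positivity) hq.ne']
  have hle : ∀ i, ‖x i‖ ≤ S := fun i => by
    rw [← Real.rpow_le_rpow_iff (norm_nonneg _) hS0 hq, ← hSq]
    exact Finset.single_le_sum (f := fun i => ‖x i‖ ^ q) (fun j _ => by positivity)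
      (Finset.mem_univ i)
  have hadd : ∀ t : ℝ, 0 ≤ t → t ^ r = t ^ q * t ^ (r - q) := fun t ht => by
    rw [← Real.rpow_add_of_nonneg ht hq.le (sub_nonneg.2 hqr), add_sub_cancel]
  rw [one_div, Real.rpow_inv_le_iff_of_pos (by positivity) hS0 hr, hadd S hS0, ← hSq,
    Finset.sum_mul]
  refine Finset.sum_le_sum fun i _ => ?_
  rw [hadd _ (norm_nonneg _)]
  exact mul_le_mul_of_nonneg_left (Real.rpow_le_rpow (norm_nonneg _) (hle i)
    (sub_nonneg.2 hqr)) (by positivity)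

variable {E : Type*} [NormedAddCommGroup E] [NormedSpace ℝ E] [Lattice E]
  [IsOrderedAddMonoid E] [IsOrderedModule ℝ E] [HasSolidNorm E]

theorem LowerEstimate.exists_propertyC {q : ℝ} (hq : 0 < q) (h : LowerEstimate E q) :
    ∃ p : Seminorm ℝ E, IsEquivLatticeNorm p ∧ PropertyC fun x : E => p x := by
  -- Minkowski's inequality needs `q ≥ 1`; smaller exponents are raised to 1.
  wlog hq1 : 1 ≤ q generalizing q
  · exact this one_pos (h.of_le hq (not_le.1 hq1).le) le_rfl
  obtain ⟨C, hC, H⟩ := h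
  have hle : ∀ (u : E) (n : ℕ) (x : Fin n → E), IsDisjointBelow x |u| →
      ∑ i, ‖x i‖ ^ q ≤ (C * ‖u‖) ^ q := by
    intro u n x hx
    have h := H n x fun i j hij => by
      rw [abs_of_nonneg (hx.1 i), abs_of_nonneg (hx.1 j), hx.2.1 i j hij]
    rw [one_div, Real.rpow_inv_le_iff_of_pos (by positivity) (by positivity) hq] at h
    refine h.trans ?_
    gcongr
    refine norm_le_norm_of_abs_le_abs ?_
    rw [abs_of_nonneg (Finset.sum_nonneg fun i _ => hx.1 i)]
    exact hx.2.2
  have hbdd : ∀ u : E, BddAbove (energySet q u) := fun u =>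
    ⟨(C * ‖u‖) ^ q, by rintro _ ⟨n, x, hx, rfl⟩; exact hle u n x hx⟩
  refine ⟨energySeminorm hq1 hbdd, ⟨⟨1, C, one_pos, hC, fun u => ⟨?_, ?_⟩⟩, fun x y hxy => ?_⟩,
    propertyC_energySeminorm hq1 hbdd⟩
  · rw [one_mul, energySeminorm_apply,
      Real.le_rpow_inv_iff_of_pos (norm_nonneg u) (energy_nonneg q u) hq]
    exact norm_rpow_le_energy hbdd u
  · rw [energySeminorm_apply,
      Real.rpow_inv_le_iff_of_pos (energy_nonneg q u) (by positivity) hq]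
    exact energy_le (hle u)
  · exact Real.rpow_le_rpow (energy_nonneg q x) (energy_mono hbdd hxy) (inv_nonneg.2 hq.le)

theorem exists_lowerEstimate_iff : (∃ q : ℝ, 0 < q ∧ LowerEstimate E q) ↔
    ∃ p : Seminorm ℝ E, IsEquivLatticeNorm p ∧ PropertyC fun x : E => p x :=
  ⟨fun ⟨_, hq, h⟩ => h.exists_propertyC hq, fun ⟨_, hp, hC⟩ => hp.exists_lowerEstimate hC⟩

end BanachLattice

namespace BanachLattice

/-! ### Transfer to complex Banach lattices. -/

namespace Complexification

/-- The embedding `ofReal` as an additive homomorphism. -/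
def ofRealHom (E : Type*) [AddCommGroup E] : E →+ Complexification E where
  toFun := ofReal
  map_zero' := rfl
  map_add' x y := by ext <;> simp [ofReal]

theorem ofRealHom_apply {E : Type*} [AddCommGroup E] (x : E) : ofRealHom E x = ofReal x := rfl

theorem ofReal_smul {E : Type*} [AddCommGroup E] [Module ℝ E] (r : ℝ) (x : E) : ofReal (r • x) = (r : ℂ) • ofReal x := by
  ext <;> simp only [ofReal, smul_re, smul_im, Complex.ofReal_re, Complex.ofReal_im, zero_smul,
    smul_zero, sub_zero, add_zero]

variable {E : Type*} [NormedAddCommGroup E] [NormedSpace ℝ E] [CompleteSpace E] [Lattice E]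
  [IsOrderedAddMonoid E] [IsOrderedModule ℝ E] [HasSolidNorm E]

theorem le_modulus (z : Complexification E) (θ : ℝ) :
    Real.cos θ • z.re + Real.sin θ • z.im ≤ modulus z :=
  (isLUB_modulus z).1 ⟨θ, rfl⟩

theorem modulus_le {z : Complexification E} {u : E}
    (h : ∀ θ : ℝ, Real.cos θ • z.re + Real.sin θ • z.im ≤ u) : modulus z ≤ u :=
  (isLUB_modulus z).2 (by rintro _ ⟨θ, rfl⟩; exact h θ)

theorem modulus_nonneg (z : Complexification E) : 0 ≤ modulus z := by
  have h1 := le_modulus z 0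
  have h2 := le_modulus z Real.pi
  simp only [Real.cos_zero, Real.sin_zero, Real.cos_pi, Real.sin_pi, one_smul, zero_smul,
    add_zero, neg_smul] at h1 h2
  exact (abs_nonneg z.re).trans (abs_le'.2 ⟨h1, h2⟩)

theorem modulus_add_le (z w : Complexification E) : modulus (z + w) ≤ modulus z + modulus w :=
  modulus_le fun θ => by
    refine le_trans (le_of_eq ?_) (add_le_add (le_modulus z θ) (le_modulus w θ))
    simp only [add_re, add_im]
    module

/-- Multiplication by `c` scales by `‖c‖` and rotates by `c.arg`, which only shifts `θ` in the
supremum. -/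
theorem modulus_smul_le (c : ℂ) (z : Complexification E) : modulus (c • z) ≤ ‖c‖ • modulus z :=
  modulus_le fun θ => by
    refine le_trans (le_of_eq ?_)
      (smul_le_smul_of_nonneg_left (le_modulus z (θ - c.arg)) (norm_nonneg c))
    have hre : ‖c‖ * Real.cos (θ - c.arg) = Real.cos θ * c.re + Real.sin θ * c.im := by
      rw [Real.cos_sub, ← Complex.norm_mul_cos_arg c, ← Complex.norm_mul_sin_arg c]
      ring
    have him : ‖c‖ * Real.sin (θ - c.arg) = Real.sin θ * c.re - Real.cos θ * c.im := by
      rw [Real.sin_sub, ← Complex.norm_mul_cos_arg c, ← Complex.norm_mul_sin_arg c]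
      ring
    simp only [smul_re, smul_im, smul_add, smul_smul, hre, him]
    module

theorem modulus_zero : modulus (0 : Complexification E) = 0 :=
  le_antisymm (modulus_le fun θ => by simp) (modulus_nonneg _)

theorem modulus_neg (z : Complexification E) : modulus (-z) = modulus z := by
  have key : ∀ w : Complexification E, modulus (-w) ≤ modulus w := fun w => by
    simpa using modulus_smul_le (-1) w
  exact le_antisymm (key z) (by simpa using key (-z))

theorem modulus_ofReal (x : E) : modulus (ofReal x) = |x| := by
  apply le_antisymm
  · refine modulus_le fun θ => ?_
    simp only [ofReal, smul_zero, add_zero]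
    refine (le_abs_self _).trans ((abs_smul_le _ _).trans ?_)
    simpa using smul_le_smul_of_nonneg_right (Real.abs_cos_le_one θ) (abs_nonneg x)
  · have h1 := le_modulus (ofReal x) 0
    have h2 := le_modulus (ofReal x) Real.pi
    simp only [ofReal, Real.cos_zero, Real.sin_zero, Real.cos_pi, Real.sin_pi, one_smul,
      zero_smul, add_zero, neg_smul] at h1 h2
    exact abs_le'.2 ⟨h1, h2⟩

theorem norm_def (z : Complexification E) : ‖z‖ = ‖modulus z‖ := rfl

theorem norm_ofReal (x : E) : ‖ofReal x‖ = ‖x‖ := by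
  rw [norm_def, modulus_ofReal, norm_abs_eq_norm]

/-- `ofReal` preserves norms and disjointness; conversely, the moduli of disjoint elements are
disjoint in `E`, and their sum is at most the modulus of the sum. -/
theorem lowerEstimate_iff (q : ℝ) :
    LowerEstimate E q ↔ BanachLattice.LowerEstimate E q := by
  constructor
  · rintro ⟨C, hC, H⟩
    refine ⟨C, hC, fun n x hd => ?_⟩
    have h := H n (fun i => ofRealHom E (x i)) fun i j hij => by
      rw [ofRealHom_apply, ofRealHom_apply, modulus_ofReal, modulus_ofReal, hd i j hij]
    rw [← map_sum] at h
    simpa only [ofRealHom_apply, norm_ofReal] using h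
  · rintro ⟨C, hC, H⟩
    refine ⟨C, hC, fun n x hd => ?_⟩
    have h := H n (fun i => modulus (x i)) fun i j hij => by
      simpa only [abs_of_nonneg (modulus_nonneg _)] using hd i j hij
    have hle : ‖∑ i, modulus (x i)‖ ≤ ‖modulus (∑ i, x i)‖ := by
      refine norm_le_norm_of_abs_le_abs ?_
      rw [abs_of_nonneg (Finset.sum_nonneg fun i _ => modulus_nonneg (x i)),
        abs_of_nonneg (modulus_nonneg (∑ i, x i))]
      exact sum_le_apply_sum_of_disjoint (m := modulus (E := E)) modulus_zero modulus_nonneg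
        modulus_add_le modulus_neg Finset.univ x fun i _ j _ => hd i j
    simp only [norm_def]
    exact h.trans (mul_le_mul_of_nonneg_left hle hC.le)

/-- The extension of a lattice norm to the complexification. -/
noncomputable def extendSeminorm (p : Seminorm ℝ E) (hp : BanachLattice.IsEquivLatticeNorm p) :
    Seminorm ℂ (Complexification E) :=
  Seminorm.ofSMulLE (fun z => p (modulus z)) (by simp [modulus_zero])
    (fun z w => (hp.mono (modulus_nonneg _) (modulus_add_le z w)).trans (map_add_le_add p _ _))
    fun c z => (hp.mono (modulus_nonneg _) (modulus_smul_le c z)).trans (by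
      rw [map_smul_eq_mul, norm_norm])

theorem extendSeminorm_apply (p : Seminorm ℝ E) (hp : BanachLattice.IsEquivLatticeNorm p)
    (z : Complexification E) : extendSeminorm p hp z = p (modulus z) := rfl

theorem isEquivLatticeNorm_extendSeminorm (p : Seminorm ℝ E)
    (hp : BanachLattice.IsEquivLatticeNorm p) : IsEquivLatticeNorm (extendSeminorm p hp) where
  equiv := by
    obtain ⟨a, b, ha, hb, h⟩ := hp.equiv
    exact ⟨a, b, ha, hb, fun z => h (modulus z)⟩
  solid z w h := hp.mono (modulus_nonneg z) h

/-- The restriction of a norm on the complexification to the real part. -/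
noncomputable def restrictSeminorm (p : Seminorm ℂ (Complexification E)) : Seminorm ℝ E :=
  Seminorm.of (fun x => p (ofReal x))
    (fun x y => (congrArg p ((ofRealHom E).map_add x y)).le.trans (map_add_le_add p _ _))
    fun r x => by rw [ofReal_smul, map_smul_eq_mul, Complex.norm_real]

theorem isEquivLatticeNorm_restrictSeminorm (p : Seminorm ℂ (Complexification E))
    (hp : IsEquivLatticeNorm p) : BanachLattice.IsEquivLatticeNorm (restrictSeminorm p) where
  equiv := by
    obtain ⟨a, b, ha, hb, h⟩ := hp.equiv
    exact ⟨a, b, ha, hb, fun x => norm_ofReal x ▸ h (ofReal x)⟩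
  solid x y h := hp.solid _ _ (by rwa [modulus_ofReal, modulus_ofReal])

/-- Restriction along `ofReal` and composition with `modulus` carry equivalent lattice norms across
without changing their values on `E`, hence preserve (C). -/
theorem exists_propertyC_iff :
    (∃ p : Seminorm ℂ (Complexification E), IsEquivLatticeNorm p ∧
        PropertyC (fun x : E => p (ofReal x))) ↔
      ∃ p : Seminorm ℝ E, BanachLattice.IsEquivLatticeNorm p ∧ PropertyC (fun x : E => p x) := by
  constructor
  · rintro ⟨p, hp, hC⟩
    exact ⟨restrictSeminorm p, isEquivLatticeNorm_restrictSeminorm p hp, hC⟩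
  · rintro ⟨p, hp, hC⟩
    refine ⟨extendSeminorm p hp, isEquivLatticeNorm_extendSeminorm p hp, ?_⟩
    simpa only [extendSeminorm_apply, modulus_ofReal, hp.apply_abs] using hC

end Complexification

end BanachLattice

theorem proposition3p1 (E : Type*) [NormedAddCommGroup E] [NormedSpace ℝ E] [CompleteSpace E]
    [Lattice E] [IsOrderedAddMonoid E] [IsOrderedModule ℝ E] [HasSolidNorm E] :
    -- the real Banach lattice `E`
    ((∃ q : ℝ, 0 < q ∧ BanachLattice.LowerEstimate E q) ↔
      ∃ p : Seminorm ℝ E, BanachLattice.IsEquivLatticeNorm p ∧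
        BanachLattice.PropertyC (fun x : E => p x)) ∧
    -- the complex Banach lattice `E ⊕ iE`, whose positive cone is that of `E`
    ((∃ q : ℝ, 0 < q ∧ BanachLattice.Complexification.LowerEstimate E q) ↔
      ∃ p : Seminorm ℂ (BanachLattice.Complexification E),
        BanachLattice.Complexification.IsEquivLatticeNorm p ∧
        BanachLattice.PropertyC
          (fun x : E => p (BanachLattice.Complexification.ofReal x))) := by
  refine ⟨BanachLattice.exists_lowerEstimate_iff, ?_⟩
  simp only [BanachLattice.Complexification.lowerEstimate_iff]
  exact BanachLattice.exists_lowerEstimate_iff.trans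
    BanachLattice.Complexification.exists_propertyC_iff.symm
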